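/- Let $\mathbb{T}^2=(\mathbb{R}/\mathbb{Z})^2$ carry the flat (Lebesgue) measure. For a bounded real vector field $v$ on $\mathbb{T}^2$ let $\dot{\mathcal I}(v)$ be the set of all complex-valued $\phi\in H^1(\mathbb{T}^2)$ with $\int_{\mathbb{T}^2}\phi\,dx\,dy=0$ such that $v\cdot\nabla\phi=i\mu\phi$ almost everywhere for some $\mu\in\mathbb{R}$ ($\nabla\phi$ is the weak gradient), and put $$r(v)=\inf_{0\ne\phi\in\dot{\mathcal I}(v)}\frac{\int_{\mathbb{T}^2}|\nabla\phi|^2\,dx\,dy}{\int_{\mathbb{T}^2}|\phi|^2\,dx\,dy}\in[0,\infty],\qquad \inf\varnothing=\infty.$$ For each integer $n\ge 1$ let $v_n=\nabla^{\perp}\Psi_n=(-\partial_y\Psi_n,\partial_x\Psi_n)$ be the cellular flow with stream function $\Psi_n(x,y)=\sin(2\pi n x)\cos(2\pi n y)$. Then there is a constant $\delta>0$, independent of $n$, such that for every $n\ge 1$ $$r(v_n)\ge\delta n^2;$$ equivalently, $\int_{\mathbb{T}^2}|\nabla\phi|^2\,dx\,dy\ge\delta n^2\int_{\mathbb{T}^2}|\phi|^2\,dx\,dy$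 for every $\phi\in\dot{\mathcal I}(v_n)$. -/

import Mathlib

open MeasureTheory
open scoped ContDiff ENNReal

namespace CellularFlow

/-- The flat torus `𝕋² = (ℝ/ℤ)²`; its `volume` is the flat measure of total mass one. -/
abbrev T2 : Type := UnitAddTorus (Fin 2)

/-- The classical `i`-th partial derivative of a function on the torus. -/
noncomputable def partialDeriv {E : Type*} [NormedAddCommGroup E] [NormedSpace ℝ E]
    (i : Fin 2) (f : T2 → E) (p : T2) : E :=
  deriv (fun t : ℝ => f (p + Pi.single i (t : UnitAddCircle))) 0

/-- Smooth complex functions on the torus: those whose `ℤ²`-periodic lift to `ℝ²` is `C^∞`. -/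
def IsSmooth (ψ : T2 → ℂ) : Prop :=
  ContDiff ℝ ∞ fun x : Fin 2 → ℝ => ψ fun i => (x i : UnitAddCircle)

/-- `G` is the weak (distributional) gradient of `φ`. -/
def HasWeakGradient (φ : T2 → ℂ) (G : T2 → Fin 2 → ℂ) : Prop :=
  ∀ (i : Fin 2) (ψ : T2 → ℂ), IsSmooth ψ →
    ∫ p, φ p * partialDeriv i ψ p = -∫ p, G p i * ψ p

/-- `φ ∈ H¹(𝕋²; ℂ)`: `φ` is square integrable with a square integrable weak gradient. -/
def MemH1 (φ : T2 → ℂ) : Prop :=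
  MemLp φ 2 volume ∧
    ∃ G : T2 → Fin 2 → ℂ, (∀ i, MemLp (fun p => G p i) 2 volume) ∧ HasWeakGradient φ G

open Classical in
/-- The weak gradient `∇φ` of `φ ∈ H¹` (unique up to null sets; by convention `0` off `H¹`). -/
noncomputable def weakGrad (φ : T2 → ℂ) : T2 → Fin 2 → ℂ :=
  if h : MemH1 φ then h.2.choose else 0

/-- The mean-zero `H¹` eigenfunctions of `v · ∇`, with eigenvalue `iμ`, `μ ∈ ℝ`
(together with the zero function). -/
def eigenfunctions (v : T2 → Fin 2 → ℝ) : Set (T2 → ℂ) :=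
  {φ | MemH1 φ ∧ ∫ p, φ p = 0 ∧
    ∃ μ : ℝ, ∀ᵐ p, ∑ i, (v p i : ℂ) * weakGrad φ p i = Complex.I * (μ : ℂ) * φ p}

/-- `∫ |φ|²`. -/
noncomputable def l2NormSq (φ : T2 → ℂ) : ℝ :=
  ∫ p, ‖φ p‖ ^ 2

/-- The Dirichlet energy `∫ |∇φ|²`. -/
noncomputable def dirichletEnergy (φ : T2 → ℂ) : ℝ :=
  ∫ p, ∑ i, ‖weakGrad φ p i‖ ^ 2

/-- `r(v)`: the infimum of the Rayleigh quotient over the nonzero mean-zero `H¹` eigenfunctions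
of `v · ∇`; it is `∞` when there are none. -/
noncomputable def rate (v : T2 → Fin 2 → ℝ) : ℝ≥0∞ :=
  ⨅ φ ∈ {φ | φ ∈ eigenfunctions v ∧ ¬ φ =ᵐ[volume] 0},
    ENNReal.ofReal (dirichletEnergy φ / l2NormSq φ)

theorem periodic_sin (n : ℕ) :
    Function.Periodic (fun x : ℝ => Real.sin (2 * Real.pi * n * x)) 1 := fun x => by
  have h : 2 * Real.pi * n * (x + 1) = 2 * Real.pi * n * x + n * (2 * Real.pi) := by ring
  simp only [h, Real.sin_add_nat_mul_two_pi]

theorem periodic_cos (n : ℕ) :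
    Function.Periodic (fun x : ℝ => Real.cos (2 * Real.pi * n * x)) 1 := fun x => by
  have h : 2 * Real.pi * n * (x + 1) = 2 * Real.pi * n * x + n * (2 * Real.pi) := by ring
  simp only [h, Real.cos_add_nat_mul_two_pi]

/-- The stream function `Ψ_n(x, y) = sin(2πnx) cos(2πny)` on the torus. -/
noncomputable def stream (n : ℕ) (p : T2) : ℝ :=
  (periodic_sin n).lift (p 0) * (periodic_cos n).lift (p 1)

/-- `∇^⊥ Ψ = (-∂_y Ψ, ∂_x Ψ)`. -/
noncomputable def gradPerp (Ψ : T2 → ℝ) (p : T2) : Fin 2 → ℝ :=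
  ![-partialDeriv 1 Ψ p, partialDeriv 0 Ψ p]

/-- The cellular flow `v_n = ∇^⊥ Ψ_n`. -/
noncomputable def cellularFlow (n : ℕ) : T2 → Fin 2 → ℝ :=
  gradPerp (stream n)

end CellularFlow

/-!
Cut the torus into the `4n²` cells bounded by the nodal lines of `Ψ_n`, squares of side
`1 / (2n)`, and let `φ` satisfy `v_n · ∇φ = {Ψ_n, φ} = iμφ`. The stream function vanishes on the
boundary of each cell, so there is no flux of `φ` through it.

If `μ ≠ 0`, integrating the equation over a cell shows that `φ` has mean zero on it. If `μ = 0`,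
then `{q ∘ Ψ_n, φ} = 0` for every `q`, so with `q(t) = 1 - exp(-m t²)` one gets
`q(Ψ_n) {ℓ, φ} = {q(Ψ_n) ℓ, φ}`, which has integral zero over the cell; hence `∫ {ℓ, φ} = 0` for
every smooth `ℓ`, letting `m → ∞`. The choices `ℓ = x`, `ℓ = y` and `ℓ = (x - x₁)(y - y₁)`, with
`(x₁, y₁)` the upper right corner of the cell, show that the averages of `φ` over its four sides
agree, and since adjacent cells share a side, the side averages of all cells are one constant `c`.

In both cases the Poincaré inequality on the cells bounds `∫ |φ - c|²`, with `c = 0` if `μ ≠ 0`,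
hence also `∫ |φ|²` since `φ` has mean zero, by `(2n²)⁻¹ ∫ |∇φ|²`.
-/

namespace CellularFlow

open Set Filter Topology

section SquareIntegrable

variable {α E : Type*} [MeasurableSpace α] {ν : Measure α} [NormedAddCommGroup E]
  [InnerProductSpace ℝ E]

theorem integral_norm_sq_eq_norm_toLp_sq {g : α → E} (hg : MemLp g 2 ν) :
    ∫ z, ‖g z‖ ^ 2 ∂ν = ‖hg.toLp g‖ ^ 2 := by
  rw [← real_inner_self_eq_norm_sq, L2.inner_def]
  refine integral_congr_ae ?_
  filter_upwards [hg.coeFn_toLp] with z hz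
  rw [hz, real_inner_self_eq_norm_sq]

theorem tendsto_integral_norm_sq {ι : Type*} {l : Filter ι} {f : ι → α → E} {F : α → E}
    (hf : ∀ k, MemLp (f k) 2 ν) (hF : MemLp F 2 ν)
    (h : Tendsto (fun k => eLpNorm (f k - F) 2 ν) l (𝓝 0)) :
    Tendsto (fun k => ∫ z, ‖f k z‖ ^ 2 ∂ν) l (𝓝 (∫ z, ‖F z‖ ^ 2 ∂ν)) := by
  simp only [integral_norm_sq_eq_norm_toLp_sq hF, integral_norm_sq_eq_norm_toLp_sq (hf _)]
  exact ((Lp.tendsto_Lp_iff_tendsto_eLpNorm'' f hf F hF).2 h).norm.pow 2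

theorem tendsto_integral_smul {ι : Type*} {l : Filter ι} {f : ι → α → E} {F : α → E} {w : α → ℝ}
    (hw : MemLp w 2 ν) (hf : ∀ k, MemLp (f k) 2 ν) (hF : MemLp F 2 ν)
    (h : Tendsto (fun k => eLpNorm (f k - F) 2 ν) l (𝓝 0)) :
    Tendsto (fun k => ∫ z, w z • f k z ∂ν) l (𝓝 (∫ z, w z • F z ∂ν)) := by
  refine tendsto_integral_of_L1' (F := fun k => w • f k) (w • F)
    (hF.smul (p := 2) (q := 2) (r := 1) hw).1
    (Eventually.of_forall fun k => memLp_one_iff_integrable.1 ((hf k).smul (p := 2) (q := 2) hw)) ?_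
  have bound (k) : eLpNorm (w • f k - w • F) 1 ν ≤ eLpNorm w 2 ν * eLpNorm (f k - F) 2 ν := by
    rw [← smul_sub]
    exact eLpNorm_smul_le_mul_eLpNorm ((hf k).sub hF).1 hw.1
  refine tendsto_of_tendsto_of_tendsto_of_le_of_le tendsto_const_nhds ?_ (fun _ => zero_le) bound
  simpa using ENNReal.Tendsto.const_mul h (Or.inr hw.2.ne)

variable [IsFiniteMeasure ν] [CompleteSpace E]

theorem integral_norm_sub_const_sq {g : α → E} (hg : MemLp g 2 ν) (c : E) :
    ∫ z, ‖g z - c‖ ^ 2 ∂ν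
      = ∫ z, ‖g z‖ ^ 2 ∂ν - 2 * inner ℝ c (∫ z, g z ∂ν) + ν.real univ * ‖c‖ ^ 2 := by
  have hi : Integrable g ν := hg.integrable one_le_two
  have hc : Integrable (fun z => 2 * inner ℝ c (g z)) ν := (hi.const_inner c).const_mul 2
  have hn : Integrable (fun z => ‖g z‖ ^ 2) ν := hg.norm.integrable_sq
  have hnc : Integrable (fun z => ‖g z‖ ^ 2 - 2 * inner ℝ c (g z)) ν := hn.sub hc
  simp only [norm_sub_sq_real, real_inner_comm c]
  rw [integral_add hnc (integrable_const _), integral_sub hn hc, integral_const_mul,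
    integral_inner hi, integral_const, smul_eq_mul]

theorem integral_norm_sq_le_of_integral_eq_zero {g : α → E} (hg : MemLp g 2 ν)
    (h0 : ∫ z, g z ∂ν = 0) (c : E) : ∫ z, ‖g z‖ ^ 2 ∂ν ≤ ∫ z, ‖g z - c‖ ^ 2 ∂ν := by
  rw [integral_norm_sub_const_sq hg, h0, inner_zero_right]
  linarith [mul_nonneg (measureReal_nonneg (μ := ν) (s := univ)) (sq_nonneg ‖c‖)]

theorem norm_integral_sq_le {g : α → E} (hg : MemLp g 2 ν) :
    ‖∫ z, g z ∂ν‖ ^ 2 ≤ ν.real univ * ∫ z, ‖g z‖ ^ 2 ∂ν := by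
  rcases eq_or_ne ν 0 with rfl | hν
  · simp
  have hm : 0 < ν.real univ := by simpa [measureReal_def, ENNReal.toReal_pos_iff] using hν
  have h : 0 ≤ ∫ z, ‖g z - (ν.real univ)⁻¹ • ∫ z, g z ∂ν‖ ^ 2 ∂ν :=
    integral_nonneg fun z => sq_nonneg _
  rw [integral_norm_sub_const_sq hg, real_inner_smul_left, real_inner_self_eq_norm_sq, norm_smul,
    Real.norm_of_nonneg (by positivity)] at h
  field_simp at h
  linarith

end SquareIntegrable

section Plane

variable {E : Type*} [NormedAddCommGroup E] [NormedSpace ℝ E]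

/-- The partial derivative `∂f/∂x` of a function on the plane. -/
noncomputable def dx (f : ℝ × ℝ → E) (z : ℝ × ℝ) : E := fderiv ℝ f z (1, 0)

/-- The partial derivative `∂f/∂y` of a function on the plane. -/
noncomputable def dy (f : ℝ × ℝ → E) (z : ℝ × ℝ) : E := fderiv ℝ f z (0, 1)

theorem hasDerivAt_dx {f : ℝ × ℝ → E} {z : ℝ × ℝ} (hf : DifferentiableAt ℝ f z) :
    HasDerivAt (fun s => f (s, z.2)) (dx f z) z.1 :=
  hf.hasFDerivAt.comp_hasDerivAt (f := fun s => (s, z.2)) z.1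
    ((hasDerivAt_id z.1).prodMk (hasDerivAt_const z.1 z.2))

theorem hasDerivAt_dy {f : ℝ × ℝ → E} {z : ℝ × ℝ} (hf : DifferentiableAt ℝ f z) :
    HasDerivAt (fun t => f (z.1, t)) (dy f z) z.2 :=
  hf.hasFDerivAt.comp_hasDerivAt (f := fun t => (z.1, t)) z.2
    ((hasDerivAt_const z.2 z.1).prodMk (hasDerivAt_id z.2))

theorem contDiff_dx {f : ℝ × ℝ → E} {m : WithTop ℕ∞} (hf : ContDiff ℝ (m + 1) f) :
    ContDiff ℝ m (dx f) :=
  (hf.fderiv_right le_rfl).clm_apply contDiff_const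

theorem contDiff_dy {f : ℝ × ℝ → E} {m : WithTop ℕ∞} (hf : ContDiff ℝ (m + 1) f) :
    ContDiff ℝ m (dy f) :=
  (hf.fderiv_right le_rfl).clm_apply contDiff_const

theorem continuous_dx {f : ℝ × ℝ → E} (hf : ContDiff ℝ 1 f) : Continuous (dx f) :=
  (contDiff_dx (m := 0) hf).continuous

theorem continuous_dy {f : ℝ × ℝ → E} (hf : ContDiff ℝ 1 f) : Continuous (dy f) :=
  (contDiff_dy (m := 0) hf).continuous

theorem dx_smul {p : ℝ × ℝ → ℝ} {f : ℝ × ℝ → E} {z : ℝ × ℝ} (hp : DifferentiableAt ℝ p z)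
    (hf : DifferentiableAt ℝ f z) :
    dx (fun z => p z • f z) z = p z • dx f z + dx p z • f z := by
  simp [dx, fderiv_fun_smul hp hf]

theorem dy_smul {p : ℝ × ℝ → ℝ} {f : ℝ × ℝ → E} {z : ℝ × ℝ} (hp : DifferentiableAt ℝ p z)
    (hf : DifferentiableAt ℝ f z) :
    dy (fun z => p z • f z) z = p z • dy f z + dy p z • f z := by
  simp [dy, fderiv_fun_smul hp hf]

theorem dx_comp {g : ℝ → ℝ} {p : ℝ × ℝ → ℝ} {z : ℝ × ℝ} (hg : DifferentiableAt ℝ g (p z))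
    (hp : DifferentiableAt ℝ p z) : dx (fun z => g (p z)) z = deriv g (p z) * dx p z := by
  simp [dx, fderiv_fun_comp z hg hp, mul_comm]

theorem dy_comp {g : ℝ → ℝ} {p : ℝ × ℝ → ℝ} {z : ℝ × ℝ} (hg : DifferentiableAt ℝ g (p z))
    (hp : DifferentiableAt ℝ p z) : dy (fun z => g (p z)) z = deriv g (p z) * dy p z := by
  simp [dy, fderiv_fun_comp z hg hp, mul_comm]

theorem dx_dy_comm {f : ℝ × ℝ → E} (hf : ContDiff ℝ 2 f) : dx (dy f) = dy (dx f) := by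
  funext z
  have hd : DifferentiableAt ℝ (fderiv ℝ f) z :=
    (hf.fderiv_right (m := 1) le_rfl).differentiable one_ne_zero z
  have hsymm := hf.contDiffAt.isSymmSndFDerivAt (x := z) (by simp)
  change fderiv ℝ (fun z => fderiv ℝ f z (0, 1)) z (1, 0)
    = fderiv ℝ (fun z => fderiv ℝ f z (1, 0)) z (0, 1)
  simpa [fderiv_clm_apply hd] using hsymm (1, 0) (0, 1)

/-- The product `∇^⊥p · (X, Y) = ∂_x p Y - ∂_y p X` of a vector field with a perpendicular
gradient; for `(X, Y) = ∇f` it is the Poisson bracket of `p` and `f`. -/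
noncomputable def bracket (p : ℝ × ℝ → ℝ) (X Y : ℝ × ℝ → E) (z : ℝ × ℝ) : E :=
  dx p z • Y z - dy p z • X z

theorem bracket_mul {p q : ℝ × ℝ → ℝ} {z : ℝ × ℝ} (hp : DifferentiableAt ℝ p z)
    (hq : DifferentiableAt ℝ q z) (X Y : ℝ × ℝ → E) :
    bracket (fun z => p z * q z) X Y z = p z • bracket q X Y z + q z • bracket p X Y z := by
  have hx := dx_smul hp hq
  have hy := dy_smul hp hq
  simp only [smul_eq_mul] at hx hy
  simp only [bracket, hx, hy]
  module

theorem bracket_comp {g : ℝ → ℝ} {p : ℝ × ℝ → ℝ} {z : ℝ × ℝ} (hg : DifferentiableAt ℝ g (p z))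
    (hp : DifferentiableAt ℝ p z) (X Y : ℝ × ℝ → E) :
    bracket (fun z => g (p z)) X Y z = deriv g (p z) • bracket p X Y z := by
  simp only [bracket, dx_comp hg hp, dy_comp hg hp]
  module

/-- The half-open rectangle with lower left corner `a` and upper right corner `b`. Adjacent
rectangles of this kind are disjoint. -/
def rect (a b : ℝ × ℝ) : Set (ℝ × ℝ) := Ioc a.1 b.1 ×ˢ Ioc a.2 b.2

theorem measurableSet_rect (a b : ℝ × ℝ) : MeasurableSet (rect a b) :=
  measurableSet_Ioc.prod measurableSet_Ioc

theorem rect_subset_Icc (a b : ℝ × ℝ) : rect a b ⊆ Icc a b := by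
  rw [Icc_prod_eq]
  exact prod_mono Ioc_subset_Icc_self Ioc_subset_Icc_self

instance isFiniteMeasure_restrict_rect (a b : ℝ × ℝ) :
    IsFiniteMeasure (volume.restrict (rect a b)) :=
  ⟨by simpa using (measure_mono (rect_subset_Icc a b)).trans_lt isCompact_Icc.measure_lt_top⟩

theorem real_restrict_rect {a b : ℝ × ℝ} (hab : a ≤ b) :
    (volume.restrict (rect a b)).real univ = (b.1 - a.1) * (b.2 - a.2) := by
  rw [measureReal_restrict_apply_univ, rect, Measure.volume_eq_prod, measureReal_prod_prod,
    Real.volume_real_Ioc_of_le hab.1, Real.volume_real_Ioc_of_le hab.2]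

theorem memLp_rect {F : Type*} [NormedAddCommGroup F] {f : ℝ × ℝ → F} (hf : Continuous f)
    (a b : ℝ × ℝ) (q : ℝ≥0∞) : MemLp f q (volume.restrict (rect a b)) := by
  obtain ⟨C, hC⟩ := isCompact_Icc.exists_bound_of_continuousOn (hf.continuousOn (s := Icc a b))
  refine MemLp.of_bound hf.aestronglyMeasurable C ?_
  filter_upwards [ae_restrict_mem (measurableSet_rect a b)] with z hz
  exact hC z (rect_subset_Icc a b hz)

theorem integrableOn_rect {F : Type*} [NormedAddCommGroup F] {f : ℝ × ℝ → F} (hf : Continuous f)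
    (a b : ℝ × ℝ) : IntegrableOn f (rect a b) :=
  memLp_one_iff_integrable.1 (memLp_rect hf a b 1)

variable {a b : ℝ × ℝ} {f : ℝ × ℝ → E}

theorem setIntegral_rect_symm (hab : a ≤ b) (hf : Continuous f) :
    ∫ z in rect a b, f z = ∫ y in a.2..b.2, ∫ x in a.1..b.1, f (x, y) := by
  simp only [intervalIntegral.integral_of_le hab.1, intervalIntegral.integral_of_le hab.2]
  have hi := integrableOn_rect hf a b
  rw [rect, IntegrableOn, Measure.volume_eq_prod, ← Measure.prod_restrict] at hi
  rw [rect, Measure.volume_eq_prod, ← Measure.prod_restrict, integral_prod_symm f hi]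

theorem restrict_rect_eq_restrict_Icc (a b : ℝ × ℝ) :
    (volume : Measure (ℝ × ℝ)).restrict (rect a b) = volume.restrict (Icc a b) := by
  rw [Icc_prod_eq]
  exact Measure.restrict_congr_set (Measure.set_prod_ae_eq Ioc_ae_eq_Icc Ioc_ae_eq_Icc)

theorem setIntegral_dx_add_dy {g : ℝ × ℝ → E} (hab : a ≤ b) (hf : ContDiff ℝ 1 f)
    (hg : ContDiff ℝ 1 g) :
    ∫ z in rect a b, (dx f z + dy g z)
      = (∫ x in a.1..b.1, g (x, b.2)) - (∫ x in a.1..b.1, g (x, a.2))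
        + (∫ y in a.2..b.2, f (b.1, y)) - ∫ y in a.2..b.2, f (a.1, y) := by
  rw [restrict_rect_eq_restrict_Icc]
  exact integral_divergence_prod_Icc_of_hasFDerivAt_of_le f g (fderiv ℝ f) (fderiv ℝ g) a b hab
    hf.continuous.continuousOn hg.continuous.continuousOn
    (fun z _ => (hf.differentiable one_ne_zero z).hasFDerivAt)
    (fun z _ => (hg.differentiable one_ne_zero z).hasFDerivAt)
    ((continuous_dx hf).add (continuous_dy hg)).continuousOn.integrableOn_Icc

theorem setIntegral_dy (hab : a ≤ b) (hf : ContDiff ℝ 1 f) :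
    ∫ z in rect a b, dy f z = (∫ x in a.1..b.1, f (x, b.2)) - ∫ x in a.1..b.1, f (x, a.2) := by
  simpa [dx] using setIntegral_dx_add_dy hab contDiff_const hf (f := fun _ => 0)

theorem setIntegral_dx (hab : a ≤ b) (hf : ContDiff ℝ 1 f) :
    ∫ z in rect a b, dx f z = (∫ y in a.2..b.2, f (b.1, y)) - ∫ y in a.2..b.2, f (a.1, y) := by
  simpa [dy] using setIntegral_dx_add_dy hab hf contDiff_const (g := fun _ => 0)

/-- Green's formula, as `{p, f} = ∂_y (f ∂_x p) - ∂_x (f ∂_y p)`. -/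
theorem setIntegral_bracket {p : ℝ × ℝ → ℝ} (hab : a ≤ b) (hp : ContDiff ℝ 2 p)
    (hf : ContDiff ℝ 1 f) :
    ∫ z in rect a b, bracket p (dx f) (dy f) z
      = (∫ x in a.1..b.1, dx p (x, b.2) • f (x, b.2))
        - (∫ x in a.1..b.1, dx p (x, a.2) • f (x, a.2))
        - (∫ y in a.2..b.2, dy p (b.1, y) • f (b.1, y))
        + ∫ y in a.2..b.2, dy p (a.1, y) • f (a.1, y) := by
  have hpx : ContDiff ℝ 1 (dx p) := contDiff_dx hp
  have hpy : ContDiff ℝ 1 (dy p) := contDiff_dy hp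
  have hX : ContDiff ℝ 1 fun z => -(dy p z • f z) := (hpy.smul hf).neg
  have hY : ContDiff ℝ 1 fun z => dx p z • f z := hpx.smul hf
  have hdiv (z) : bracket p (dx f) (dy f) z
      = dx (fun z => -(dy p z • f z)) z + dy (fun z => dx p z • f z) z := by
    have hfz := hf.differentiable one_ne_zero z
    have hneg : dx (fun z => -(dy p z • f z)) z = -dx (fun z => dy p z • f z) z := by
      simp [dx, fderiv_fun_neg]
    rw [hneg, dx_smul (hpy.differentiable one_ne_zero z) hfz,
      dy_smul (hpx.differentiable one_ne_zero z) hfz, ← dx_dy_comm hp, bracket]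
    abel
  simp only [hdiv]
  rw [setIntegral_dx_add_dy hab hX hY]
  simp only [intervalIntegral.integral_neg]
  abel

end Plane

section Edges

variable {E : Type*} [NormedAddCommGroup E] [NormedSpace ℝ E] {a b : ℝ × ℝ} {p : ℝ × ℝ → ℝ}
  {f : ℝ × ℝ → E}

theorem mem_frontier_Icc_iff (hab : a ≤ b) {z : ℝ × ℝ} :
    z ∈ frontier (Icc a b) ↔ z.1 ∈ Icc a.1 b.1 ∧ (z.2 = a.2 ∨ z.2 = b.2) ∨
      (z.1 = a.1 ∨ z.1 = b.1) ∧ z.2 ∈ Icc a.2 b.2 := by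
  rw [Icc_prod_eq, frontier_prod_eq, frontier_Icc hab.1, frontier_Icc hab.2, closure_Icc,
    closure_Icc]
  rfl

theorem dx_eq_zero_of_eventually {z : ℝ × ℝ} (hf : DifferentiableAt ℝ f z)
    (h : ∀ᶠ s in 𝓝 z.1, f (s, z.2) = 0) : dx f z = 0 :=
  (hasDerivAt_dx hf).unique ((hasDerivAt_const z.1 0).congr_of_eventuallyEq h)

theorem dy_eq_zero_of_eventually {z : ℝ × ℝ} (hf : DifferentiableAt ℝ f z)
    (h : ∀ᶠ t in 𝓝 z.2, f (z.1, t) = 0) : dy f z = 0 :=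
  (hasDerivAt_dy hf).unique ((hasDerivAt_const z.2 0).congr_of_eventuallyEq h)

theorem integral_dx_smul_eq_zero (hab : a ≤ b) (hp : Differentiable ℝ p)
    (h0 : EqOn p 0 (frontier (Icc a b))) {y : ℝ} (hy : y = a.2 ∨ y = b.2) (g : ℝ → E) :
    ∫ x in a.1..b.1, dx p (x, y) • g x = 0 := by
  rw [intervalIntegral.integral_congr_Ioo_of_le (g := fun _ => 0) hab.1 fun x hx => ?_,
    intervalIntegral.integral_zero]
  have h : ∀ᶠ s in 𝓝 x, p (s, y) = 0 := eventually_of_mem (Ioo_mem_nhds hx.1 hx.2) fun s hs =>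
    h0 ((mem_frontier_Icc_iff hab).2 (Or.inl ⟨Ioo_subset_Icc_self hs, hy⟩))
  simp only [dx_eq_zero_of_eventually (hp (x, y)) h, zero_smul]

theorem integral_dy_smul_eq_zero (hab : a ≤ b) (hp : Differentiable ℝ p)
    (h0 : EqOn p 0 (frontier (Icc a b))) {x : ℝ} (hx : x = a.1 ∨ x = b.1) (g : ℝ → E) :
    ∫ y in a.2..b.2, dy p (x, y) • g y = 0 := by
  rw [intervalIntegral.integral_congr_Ioo_of_le (g := fun _ => 0) hab.2 fun y hy => ?_,
    intervalIntegral.integral_zero]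
  have h : ∀ᶠ t in 𝓝 y, p (x, t) = 0 := eventually_of_mem (Ioo_mem_nhds hy.1 hy.2) fun t ht =>
    h0 ((mem_frontier_Icc_iff hab).2 (Or.inr ⟨hx, Ioo_subset_Icc_self ht⟩))
  simp only [dy_eq_zero_of_eventually (hp (x, y)) h, zero_smul]

theorem setIntegral_bracket_eq_zero (hab : a ≤ b) (hp : ContDiff ℝ 2 p)
    (h0 : EqOn p 0 (frontier (Icc a b))) (hf : ContDiff ℝ 1 f) :
    ∫ z in rect a b, bracket p (dx f) (dy f) z = 0 := by
  have hd := hp.differentiable two_ne_zero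
  rw [setIntegral_bracket hab hp hf]
  simp only [integral_dx_smul_eq_zero hab hd h0 (Or.inl rfl),
    integral_dx_smul_eq_zero hab hd h0 (Or.inr rfl),
    integral_dy_smul_eq_zero hab hd h0 (Or.inl rfl),
    integral_dy_smul_eq_zero hab hd h0 (Or.inr rfl), sub_zero, add_zero]

theorem bracket_fst (X Y : ℝ × ℝ → E) : bracket Prod.fst X Y = Y := by
  funext z
  simp [bracket, dx, dy, fderiv_fst]

theorem bracket_snd (X Y : ℝ × ℝ → E) : bracket Prod.snd X Y = -X := by
  funext z
  simp [bracket, dx, dy, fderiv_snd]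

theorem average_top_sub_average_bottom (hab : a ≤ b) (hf : ContDiff ℝ 1 f) :
    (⨍ x in a.1..b.1, f (x, b.2)) - ⨍ x in a.1..b.1, f (x, a.2)
      = (b.1 - a.1)⁻¹ • ∫ z in rect a b, bracket Prod.fst (dx f) (dy f) z := by
  rw [interval_average_eq, interval_average_eq, ← smul_sub, bracket_fst, setIntegral_dy hab hf]

theorem average_left_sub_average_right (hab : a ≤ b) (hf : ContDiff ℝ 1 f) :
    (⨍ y in a.2..b.2, f (a.1, y)) - ⨍ y in a.2..b.2, f (b.1, y)
      = (b.2 - a.2)⁻¹ • ∫ z in rect a b, bracket Prod.snd (dx f) (dy f) z := by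
  rw [interval_average_eq, interval_average_eq, ← smul_sub, bracket_snd,
    ← neg_sub (∫ y in a.2..b.2, f (b.1, y)), ← setIntegral_dx hab hf, ← integral_neg]
  rfl

theorem average_bottom_sub_average_left (h1 : a.1 < b.1) (h2 : a.2 < b.2) (hf : ContDiff ℝ 1 f) :
    (⨍ x in a.1..b.1, f (x, a.2)) - ⨍ y in a.2..b.2, f (a.1, y)
      = ((b.1 - a.1) * (b.2 - a.2))⁻¹ •
        ∫ z in rect a b, bracket (fun z => (z.1 - b.1) * (z.2 - b.2)) (dx f) (dy f) z := by
  have hx (z : ℝ × ℝ) : DifferentiableAt ℝ (fun z : ℝ × ℝ => z.1 - b.1) z := by fun_prop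
  have hy (z : ℝ × ℝ) : DifferentiableAt ℝ (fun z : ℝ × ℝ => z.2 - b.2) z := by fun_prop
  have hdx (z) : dx (fun z : ℝ × ℝ => (z.1 - b.1) * (z.2 - b.2)) z = z.2 - b.2 := by
    simp [dx, fderiv_fun_mul (hx z) (hy z), fderiv_sub_const, fderiv_fst, fderiv_snd]
  have hdy (z) : dy (fun z : ℝ × ℝ => (z.1 - b.1) * (z.2 - b.2)) z = z.1 - b.1 := by
    simp [dy, fderiv_fun_mul (hx z) (hy z), fderiv_sub_const, fderiv_fst, fderiv_snd]
  rw [setIntegral_bracket ⟨h1.le, h2.le⟩ (by fun_prop) hf, interval_average_eq,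
    interval_average_eq]
  simp only [hdx, hdy, sub_self, zero_smul, intervalIntegral.integral_zero,
    intervalIntegral.integral_smul]
  have hw : b.1 - a.1 ≠ 0 := (sub_pos.2 h1).ne'
  have hh : b.2 - a.2 ≠ 0 := (sub_pos.2 h2).ne'
  match_scalars <;> field_simp <;> ring

theorem average_bottom_eq (h1 : a.1 ≤ b.1) (h2 : a.2 < b.2) (hf : ContDiff ℝ 1 f) :
    ⨍ x in a.1..b.1, f (x, a.2) = ((b.1 - a.1) * (b.2 - a.2))⁻¹ •
      ((∫ z in rect a b, (z.2 - b.2) • dy f z) + ∫ z in rect a b, f z) := by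
  have hy (z : ℝ × ℝ) : DifferentiableAt ℝ (fun z : ℝ × ℝ => z.2 - b.2) z := by fun_prop
  have hdy (z : ℝ × ℝ) : dy (fun z : ℝ × ℝ => (z.2 - b.2) • f z) z
      = (z.2 - b.2) • dy f z + f z := by
    rw [dy_smul (hy z) (hf.differentiable one_ne_zero z)]
    simp [dy, fderiv_sub_const, fderiv_snd]
  have hg : ContDiff ℝ 1 fun z : ℝ × ℝ => (z.2 - b.2) • f z :=
    (contDiff_snd.sub contDiff_const).smul hf
  have hcy : Continuous fun z : ℝ × ℝ => (z.2 - b.2) • dy f z :=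
    (continuous_snd.sub continuous_const).smul (continuous_dy hf)
  have h := setIntegral_dy ⟨h1, h2.le⟩ hg
  simp only [hdy, sub_self, zero_smul, intervalIntegral.integral_zero,
    intervalIntegral.integral_smul] at h
  rw [← integral_add (integrableOn_rect hcy a b) (integrableOn_rect hf.continuous a b), h,
    interval_average_eq]
  have hh : b.2 - a.2 ≠ 0 := (sub_pos.2 h2).ne'
  match_scalars
  field_simp
  ring

/-- On each of the four edges of `rect a b`, the averages of `f k` tend to `c`. -/
structure EdgeAveragesTendsto {ι : Type*} (f : ι → ℝ × ℝ → E) (l : Filter ι)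
    (a b : ℝ × ℝ) (c : E) : Prop where
  bottom : Tendsto (fun k => ⨍ x in a.1..b.1, f k (x, a.2)) l (𝓝 c)
  top : Tendsto (fun k => ⨍ x in a.1..b.1, f k (x, b.2)) l (𝓝 c)
  left : Tendsto (fun k => ⨍ y in a.2..b.2, f k (a.1, y)) l (𝓝 c)
  right : Tendsto (fun k => ⨍ y in a.2..b.2, f k (b.1, y)) l (𝓝 c)

end Edges

section Poincare

theorem norm_sub_le_integral_norm_deriv {E : Type*} [NormedAddCommGroup E] [NormedSpace ℝ E]
    [CompleteSpace E] {g g' : ℝ → E} {a b s t : ℝ} (hg : ∀ r, HasDerivAt g (g' r) r)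
    (hg' : Continuous g') (hs : s ∈ Icc a b) (ht : t ∈ Icc a b) :
    ‖g t - g s‖ ≤ ∫ r in a..b, ‖g' r‖ := by
  rw [← intervalIntegral.integral_eq_sub_of_hasDerivAt (fun r _ => hg r)
    (hg'.intervalIntegrable s t)]
  refine intervalIntegral.norm_integral_le_integral_norm_uIoc.trans ?_
  rw [intervalIntegral.integral_of_le (hs.1.trans hs.2)]
  exact setIntegral_mono_set (hg'.norm.integrableOn_Icc.mono_set Ioc_subset_Icc_self)
    (Eventually.of_forall fun r => norm_nonneg _)
    (Ioc_subset_Ioc (le_min hs.1 ht.1) (max_le hs.2 ht.2)).eventuallyLE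

theorem norm_sub_average_sq_le {E : Type*} [NormedAddCommGroup E] [NormedSpace ℝ E]
    [CompleteSpace E] {g g' : ℝ → E} {a b x : ℝ} (hg : ∀ t, HasDerivAt g (g' t) t)
    (hg' : Continuous g') (hx : x ∈ Ioc a b) :
    ‖g x - ⨍ s in a..b, g s‖ ^ 2 ≤ (b - a) * ∫ s in a..b, ‖g' s‖ ^ 2 := by
  have hab : a < b := hx.1.trans_le hx.2
  have hlen : 0 < b - a := sub_pos.2 hab
  have hcont : Continuous g := continuous_iff_continuousAt.2 fun t => (hg t).continuousAt
  have hsub : g x - ⨍ s in a..b, g s = (b - a)⁻¹ • ∫ s in a..b, (g x - g s) := by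
    rw [intervalIntegral.integral_sub intervalIntegrable_const (hcont.intervalIntegrable a b),
      intervalIntegral.integral_const, smul_sub, inv_smul_smul₀ hlen.ne', interval_average_eq]
  have hnorm : ‖g x - ⨍ s in a..b, g s‖ ≤ ∫ t in a..b, ‖g' t‖ := by
    rw [hsub, norm_smul, norm_inv, Real.norm_of_nonneg hlen.le, inv_mul_le_iff₀ hlen, mul_comm]
    refine (intervalIntegral.norm_integral_le_of_norm_le_const fun s hs => ?_).trans_eq
      (by rw [abs_of_pos hlen])
    rw [uIoc_of_le hab.le] at hs
    exact norm_sub_le_integral_norm_deriv hg hg' (Ioc_subset_Icc_self hs) (Ioc_subset_Icc_self hx)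
  have hmemLp : MemLp (fun t => ‖g' t‖) 2 (volume.restrict (Ioc a b)) :=
    (memLp_two_iff_integrable_sq hg'.norm.aestronglyMeasurable).2
      ((hg'.norm.pow 2).integrableOn_Icc.mono_set Ioc_subset_Icc_self)
  have hcs := norm_integral_sq_le hmemLp
  rw [measureReal_restrict_apply_univ, Real.volume_real_Ioc_of_le hab.le] at hcs
  simp only [Real.norm_eq_abs, sq_abs, ← intervalIntegral.integral_of_le hab.le] at hcs
  exact (pow_le_pow_left₀ (norm_nonneg _) hnorm 2).trans hcs

variable {E : Type*} [NormedAddCommGroup E] [InnerProductSpace ℝ E] [CompleteSpace E]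
  {a b : ℝ × ℝ} {f : ℝ × ℝ → E}

theorem norm_average_sub_average_sq_le (hf : ContDiff ℝ 1 f) {z : ℝ × ℝ} (hz : z ∈ rect a b) :
    ‖(⨍ s in a.1..b.1, f (s, z.2)) - ⨍ s in a.1..b.1, f (s, a.2)‖ ^ 2
      ≤ (b.2 - a.2) / (b.1 - a.1) * ∫ z in rect a b, ‖dy f z‖ ^ 2 := by
  have hw : 0 < b.1 - a.1 := sub_pos.2 (hz.1.1.trans_le hz.1.2)
  have hle : a ≤ (b.1, z.2) := ⟨(hz.1.1.trans_le hz.1.2).le, hz.2.1.le⟩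
  have hcs := norm_integral_sq_le (memLp_rect (continuous_dy hf) a (b.1, z.2) 2)
  have hmono : ∫ u in rect a (b.1, z.2), ‖dy f u‖ ^ 2 ≤ ∫ u in rect a b, ‖dy f u‖ ^ 2 :=
    setIntegral_mono_set (integrableOn_rect ((continuous_dy hf).norm.pow 2) a b)
      (Eventually.of_forall fun u => sq_nonneg _)
      (prod_mono_right (Ioc_subset_Ioc_right hz.2.2)).eventuallyLE
  rw [real_restrict_rect hle] at hcs
  rw [interval_average_eq, interval_average_eq, ← smul_sub, ← setIntegral_dy hle hf, norm_smul,
    norm_inv, Real.norm_of_nonneg hw.le, mul_pow]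
  calc ((b.1 - a.1)⁻¹) ^ 2 * ‖∫ u in rect a (b.1, z.2), dy f u‖ ^ 2
      ≤ ((b.1 - a.1)⁻¹) ^ 2 * ((b.1 - a.1) * (z.2 - a.2)
          * ∫ u in rect a (b.1, z.2), ‖dy f u‖ ^ 2) := by gcongr
    _ ≤ ((b.1 - a.1)⁻¹) ^ 2 * ((b.1 - a.1) * (b.2 - a.2) * ∫ u in rect a b, ‖dy f u‖ ^ 2) := by
        gcongr
        · exact mul_nonneg hw.le (sub_nonneg.2 (hz.2.1.le.trans hz.2.2))
        · exact hz.2.2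
    _ = (b.2 - a.2) / (b.1 - a.1) * ∫ u in rect a b, ‖dy f u‖ ^ 2 := by field_simp

theorem setIntegral_norm_sub_average_sq_le (h1 : a.1 < b.1) (h2 : a.2 < b.2)
    (hf : ContDiff ℝ 1 f) :
    ∫ z in rect a b, ‖f z - ⨍ s in a.1..b.1, f (s, a.2)‖ ^ 2
      ≤ 2 * (b.1 - a.1) ^ 2 * (∫ z in rect a b, ‖dx f z‖ ^ 2)
        + 2 * (b.2 - a.2) ^ 2 * ∫ z in rect a b, ‖dy f z‖ ^ 2 := by
  have hab : a ≤ b := ⟨h1.le, h2.le⟩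
  have hw : b.1 - a.1 ≠ 0 := (sub_pos.2 h1).ne'
  have hcx : Continuous fun z => ‖dx f z‖ ^ 2 := (continuous_dx hf).norm.pow 2
  let rowEnergy (z : ℝ × ℝ) : ℝ := ∫ s in a.1..b.1, ‖dx f (s, z.2)‖ ^ 2
  set energy := ∫ z in rect a b, ‖dy f z‖ ^ 2
  have hrow : Continuous rowEnergy :=
    intervalIntegral.continuous_parametric_intervalIntegral_of_continuous'
      (f := fun (z : ℝ × ℝ) s => ‖dx f (s, z.2)‖ ^ 2)
      (hcx.comp (continuous_snd.prodMk (continuous_snd.comp continuous_fst))) _ _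
  have hpoint : ∀ z ∈ rect a b, ‖f z - ⨍ s in a.1..b.1, f (s, a.2)‖ ^ 2
      ≤ 2 * (b.1 - a.1) * rowEnergy z + 2 * ((b.2 - a.2) / (b.1 - a.1)) * energy := by
    intro z hz
    have hx := norm_sub_average_sq_le (g := fun s => f (s, z.2)) (g' := fun s => dx f (s, z.2))
      (fun s => hasDerivAt_dx (hf.differentiable one_ne_zero (s, z.2)))
      ((continuous_dx hf).comp (continuous_id.prodMk continuous_const)) hz.1
    have hy := norm_average_sub_average_sq_le hf hz
    have htri := norm_sub_le_norm_sub_add_norm_sub (f z) (⨍ s in a.1..b.1, f (s, z.2))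
      (⨍ s in a.1..b.1, f (s, a.2))
    have := (pow_le_pow_left₀ (norm_nonneg _) htri 2).trans add_sq_le
    linarith
  have hrowint : ∫ z in rect a b, rowEnergy z = (b.1 - a.1) * ∫ z in rect a b, ‖dx f z‖ ^ 2 := by
    rw [setIntegral_rect_symm hab hrow, setIntegral_rect_symm hab hcx]
    simp [rowEnergy]
  calc ∫ z in rect a b, ‖f z - ⨍ s in a.1..b.1, f (s, a.2)‖ ^ 2
      ≤ ∫ z in rect a b,
          (2 * (b.1 - a.1) * rowEnergy z + 2 * ((b.2 - a.2) / (b.1 - a.1)) * energy) :=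
        setIntegral_mono_on
          (integrableOn_rect ((hf.continuous.sub continuous_const).norm.pow 2) a b)
          (integrableOn_rect ((hrow.const_mul _).add continuous_const) a b)
          (measurableSet_rect a b) hpoint
    _ = 2 * (b.1 - a.1) ^ 2 * (∫ z in rect a b, ‖dx f z‖ ^ 2) + 2 * (b.2 - a.2) ^ 2 * energy := by
        rw [integral_add (integrableOn_rect (hrow.const_mul _) a b) (integrable_const _),
          integral_const_mul, hrowint, integral_const, real_restrict_rect hab, smul_eq_mul]
        field_simp

end Poincare

section Limits

variable {ι E : Type*} [NormedAddCommGroup E] [InnerProductSpace ℝ E] {l : Filter ι}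
  {f : ι → ℝ × ℝ → E} {F X Y : ℝ × ℝ → E} {a b : ℝ × ℝ} {p : ℝ × ℝ → ℝ}

/-- Convergence in `H¹(s)` of `C¹` functions `f k` to `F`, with `(X, Y)` as the gradient of the
limit. It replaces membership of `F` in `H¹(s)`, for which traces on edges would be needed. -/
structure H1Tendsto (f : ι → ℝ × ℝ → E) (l : Filter ι) (s : Set (ℝ × ℝ)) (F X Y : ℝ × ℝ → E) :
    Prop where
  contDiff (k : ι) : ContDiff ℝ 1 (f k)
  memLp : MemLp F 2 (volume.restrict s)
  memLp_dx : MemLp X 2 (volume.restrict s)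
  memLp_dy : MemLp Y 2 (volume.restrict s)
  tendsto : Tendsto (fun k => eLpNorm (f k - F) 2 (volume.restrict s)) l (𝓝 0)
  tendsto_dx : Tendsto (fun k => eLpNorm (dx (f k) - X) 2 (volume.restrict s)) l (𝓝 0)
  tendsto_dy : Tendsto (fun k => eLpNorm (dy (f k) - Y) 2 (volume.restrict s)) l (𝓝 0)

namespace H1Tendsto

theorem mono {s t : Set (ℝ × ℝ)} (h : H1Tendsto f l t F X Y) (hst : s ⊆ t) :
    H1Tendsto f l s F X Y := by
  have hle : volume.restrict s ≤ volume.restrict t := Measure.restrict_mono_set volume hst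
  have squeeze {g : ι → ℝ × ℝ → E}
      (hg : Tendsto (fun k => eLpNorm (g k) 2 (volume.restrict t)) l (𝓝 0)) :
      Tendsto (fun k => eLpNorm (g k) 2 (volume.restrict s)) l (𝓝 0) :=
    tendsto_of_tendsto_of_tendsto_of_le_of_le tendsto_const_nhds hg (fun _ => zero_le)
      fun k => eLpNorm_mono_measure (g k) hle
  exact ⟨h.contDiff, h.memLp.mono_measure hle, h.memLp_dx.mono_measure hle,
    h.memLp_dy.mono_measure hle, squeeze h.tendsto, squeeze h.tendsto_dx, squeeze h.tendsto_dy⟩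

variable (h : H1Tendsto f l (rect a b) F X Y)
include h

theorem tendsto_setIntegral_smul {w : ℝ × ℝ → ℝ} (hw : Continuous w) :
    Tendsto (fun k => ∫ z in rect a b, w z • f k z) l (𝓝 (∫ z in rect a b, w z • F z)) :=
  tendsto_integral_smul (memLp_rect hw a b 2)
    (fun k => memLp_rect (h.contDiff k).continuous a b 2) h.memLp h.tendsto

theorem tendsto_setIntegral_smul_dx {w : ℝ × ℝ → ℝ} (hw : Continuous w) :
    Tendsto (fun k => ∫ z in rect a b, w z • dx (f k) z) l (𝓝 (∫ z in rect a b, w z • X z)) :=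
  tendsto_integral_smul (memLp_rect hw a b 2)
    (fun k => memLp_rect (continuous_dx (h.contDiff k)) a b 2) h.memLp_dx h.tendsto_dx

theorem tendsto_setIntegral_smul_dy {w : ℝ × ℝ → ℝ} (hw : Continuous w) :
    Tendsto (fun k => ∫ z in rect a b, w z • dy (f k) z) l (𝓝 (∫ z in rect a b, w z • Y z)) :=
  tendsto_integral_smul (memLp_rect hw a b 2)
    (fun k => memLp_rect (continuous_dy (h.contDiff k)) a b 2) h.memLp_dy h.tendsto_dy

theorem integrableOn_smul_dx {w : ℝ × ℝ → ℝ} (hw : Continuous w) :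
    IntegrableOn (fun z => w z • X z) (rect a b) :=
  memLp_one_iff_integrable.1 (h.memLp_dx.smul (p := 2) (q := 2) (memLp_rect hw a b 2))

theorem integrableOn_smul_dy {w : ℝ × ℝ → ℝ} (hw : Continuous w) :
    IntegrableOn (fun z => w z • Y z) (rect a b) :=
  memLp_one_iff_integrable.1 (h.memLp_dy.smul (p := 2) (q := 2) (memLp_rect hw a b 2))

theorem integrableOn_bracket (hp : ContDiff ℝ 1 p) : IntegrableOn (bracket p X Y) (rect a b) :=
  (h.integrableOn_smul_dy (continuous_dx hp)).sub (h.integrableOn_smul_dx (continuous_dy hp))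

theorem tendsto_setIntegral_bracket (hp : ContDiff ℝ 1 p) :
    Tendsto (fun k => ∫ z in rect a b, bracket p (dx (f k)) (dy (f k)) z) l
      (𝓝 (∫ z in rect a b, bracket p X Y z)) := by
  have hcx := continuous_dx hp
  have hcy := continuous_dy hp
  simp only [bracket]
  rw [integral_sub (h.integrableOn_smul_dy hcx) (h.integrableOn_smul_dx hcy)]
  refine ((h.tendsto_setIntegral_smul_dy hcx).sub (h.tendsto_setIntegral_smul_dx hcy)).congr
    fun k => ?_
  exact (integral_sub (integrableOn_rect (hcx.smul (continuous_dy (h.contDiff k))) a b)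
    (integrableOn_rect (hcy.smul (continuous_dx (h.contDiff k))) a b)).symm

theorem setIntegral_bracket_eq_zero [l.NeBot] (hab : a ≤ b) (hp : ContDiff ℝ 2 p)
    (h0 : EqOn p 0 (frontier (Icc a b))) : ∫ z in rect a b, bracket p X Y z = 0 := by
  refine tendsto_nhds_unique (h.tendsto_setIntegral_bracket (hp.of_le one_le_two)) ?_
  simp only [CellularFlow.setIntegral_bracket_eq_zero hab hp h0 (h.contDiff _)]
  exact tendsto_const_nhds

/-- If `∇^⊥p · ∇F = 0`, the vector field `∇F` is parallel to `∇p`, so `ℓ` may be tested against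
`F` after cutting it off near the streamline `p = 0` with a function of `p`. -/
theorem setIntegral_bracket_eq_zero_of_ae_eq_zero [l.NeBot] (hab : a ≤ b) (hp : ContDiff ℝ 2 p)
    (h0 : EqOn p 0 (frontier (Icc a b))) (hne : ∀ᵐ z ∂volume.restrict (rect a b), p z ≠ 0)
    (hpar : ∀ᵐ z ∂volume.restrict (rect a b), bracket p X Y z = 0) {ℓ : ℝ × ℝ → ℝ}
    (hℓ : ContDiff ℝ 2 ℓ) : ∫ z in rect a b, bracket ℓ X Y z = 0 := by
  let cutoff (m : ℕ) (t : ℝ) : ℝ := 1 - Real.exp (-(m * t ^ 2))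
  have hcutoff (m) : ContDiff ℝ 2 (cutoff m) := by fun_prop
  have hzero (m : ℕ) : ∫ z in rect a b, cutoff m (p z) • bracket ℓ X Y z = 0 := by
    rw [← h.setIntegral_bracket_eq_zero hab (((hcutoff m).comp hp).mul hℓ) fun z hz => by
      simp [cutoff, h0 hz]]
    refine integral_congr_ae (hpar.mono fun z hz => ?_)
    have hpz := hp.differentiable two_ne_zero z
    have hcz := (hcutoff m).differentiable two_ne_zero (p z)
    have hmul := bracket_mul (p := fun z => cutoff m (p z)) (hcz.comp z hpz)
      (hℓ.differentiable two_ne_zero z) X Y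
    rw [bracket_comp hcz hpz, hz, smul_zero, smul_zero, add_zero] at hmul
    exact hmul.symm
  have hlim : Tendsto (fun m : ℕ => ∫ z in rect a b, cutoff m (p z) • bracket ℓ X Y z) atTop
      (𝓝 (∫ z in rect a b, bracket ℓ X Y z)) := by
    have hint := h.integrableOn_bracket (hℓ.of_le one_le_two)
    refine tendsto_integral_of_dominated_convergence (fun z => ‖bracket ℓ X Y z‖)
      (fun m => ((hcutoff m).continuous.comp hp.continuous).aestronglyMeasurable.smul hint.1)
      hint.norm (fun m => Eventually.of_forall fun z => ?_) (hne.mono fun z hz => ?_)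
    · have hexp : Real.exp (-(m * p z ^ 2)) ≤ 1 :=
        Real.exp_le_one_iff.2 (neg_nonpos.2 (by positivity))
      rw [norm_smul, Real.norm_of_nonneg (sub_nonneg.2 hexp)]
      exact mul_le_of_le_one_left (norm_nonneg _) (sub_le_self _ (Real.exp_pos _).le)
    · have hdiv : Tendsto (fun m : ℕ => (m : ℝ) * p z ^ 2) atTop atTop :=
        tendsto_natCast_atTop_atTop.atTop_mul_const (by positivity)
      simpa [cutoff] using ((Real.tendsto_exp_neg_atTop_nhds_zero.comp hdiv).const_sub 1).smul_const
        (bracket ℓ X Y z)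
  simp only [hzero] at hlim
  exact tendsto_nhds_unique hlim tendsto_const_nhds

theorem setIntegral_norm_sub_sq_le [CompleteSpace E] [l.NeBot] (h1 : a.1 < b.1) (h2 : a.2 < b.2)
    {c : E} (hc : Tendsto (fun k => ⨍ x in a.1..b.1, f k (x, a.2)) l (𝓝 c)) :
    ∫ z in rect a b, ‖F z - c‖ ^ 2
      ≤ 2 * (b.1 - a.1) ^ 2 * (∫ z in rect a b, ‖X z‖ ^ 2)
        + 2 * (b.2 - a.2) ^ 2 * ∫ z in rect a b, ‖Y z‖ ^ 2 := by
  have hmemLp (k) : MemLp (f k) 2 (volume.restrict (rect a b)) :=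
    memLp_rect (h.contDiff k).continuous a b 2
  have hmean := h.tendsto_setIntegral_smul (w := fun _ => 1) continuous_const
  simp only [one_smul] at hmean
  have hleft : Tendsto (fun k => ∫ z in rect a b, ‖f k z - ⨍ x in a.1..b.1, f k (x, a.2)‖ ^ 2) l
      (𝓝 (∫ z in rect a b, ‖F z - c‖ ^ 2)) := by
    simp only [integral_norm_sub_const_sq (hmemLp _), integral_norm_sub_const_sq h.memLp]
    exact ((tendsto_integral_norm_sq hmemLp h.memLp h.tendsto).sub
      ((hc.inner hmean).const_mul 2)).add ((hc.norm.pow 2).const_mul _)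
  have hX := tendsto_integral_norm_sq
    (fun k => memLp_rect (continuous_dx (h.contDiff k)) a b 2) h.memLp_dx h.tendsto_dx
  have hY := tendsto_integral_norm_sq
    (fun k => memLp_rect (continuous_dy (h.contDiff k)) a b 2) h.memLp_dy h.tendsto_dy
  exact le_of_tendsto_of_tendsto' hleft ((hX.const_mul _).add (hY.const_mul _))
    fun k => setIntegral_norm_sub_average_sq_le h1 h2 (h.contDiff k)

theorem exists_tendsto_average_bottom (h1 : a.1 ≤ b.1) (h2 : a.2 < b.2) :
    ∃ c, Tendsto (fun k => ⨍ x in a.1..b.1, f k (x, a.2)) l (𝓝 c) := by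
  have hmean := h.tendsto_setIntegral_smul (w := fun _ => 1) continuous_const
  have hY := h.tendsto_setIntegral_smul_dy (continuous_snd.sub (continuous_const (y := b.2)))
  simp only [one_smul] at hmean
  simp only [average_bottom_eq h1 h2 (h.contDiff _)]
  exact ⟨_, (hY.add hmean).const_smul _⟩

theorem exists_edgeAveragesTendsto (h1 : a.1 < b.1) (h2 : a.2 < b.2)
    (h0 : ∀ ℓ : ℝ × ℝ → ℝ, ContDiff ℝ 2 ℓ → ∫ z in rect a b, bracket ℓ X Y z = 0) :
    ∃ c, EdgeAveragesTendsto f l a b c := by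
  have hab : a ≤ b := ⟨h1.le, h2.le⟩
  have hlim {ℓ : ℝ × ℝ → ℝ} (hℓ : ContDiff ℝ 2 ℓ) (t : ℝ) :
      Tendsto (fun k => t • ∫ z in rect a b, bracket ℓ (dx (f k)) (dy (f k)) z) l (𝓝 0) := by
    simpa [h0 ℓ hℓ] using (h.tendsto_setIntegral_bracket (hℓ.of_le one_le_two)).const_smul t
  obtain ⟨c, bottom⟩ := h.exists_tendsto_average_bottom h1.le h2
  have top : Tendsto (fun k => ⨍ x in a.1..b.1, f k (x, b.2)) l (𝓝 c) := by
    simpa [← average_top_sub_average_bottom hab (h.contDiff _)]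
      using (hlim contDiff_fst (b.1 - a.1)⁻¹).add bottom
  have left : Tendsto (fun k => ⨍ y in a.2..b.2, f k (a.1, y)) l (𝓝 c) := by
    simpa [-mul_inv_rev, ← average_bottom_sub_average_left h1 h2 (h.contDiff _)] using bottom.sub
      (hlim (ℓ := fun z => (z.1 - b.1) * (z.2 - b.2)) (by fun_prop)
        ((b.1 - a.1) * (b.2 - a.2))⁻¹)
  have right : Tendsto (fun k => ⨍ y in a.2..b.2, f k (b.1, y)) l (𝓝 c) := by
    simpa [← average_left_sub_average_right hab (h.contDiff _)]
      using left.sub (hlim contDiff_snd (b.2 - a.2)⁻¹)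
  exact ⟨c, bottom, top, left, right⟩

end H1Tendsto

theorem H1Tendsto.setIntegral_eq_zero {f : ι → ℝ × ℝ → ℂ} {F X Y : ℝ × ℝ → ℂ}
    (h : H1Tendsto f l (rect a b) F X Y) [l.NeBot] (hab : a ≤ b) (hp : ContDiff ℝ 2 p)
    (h0 : EqOn p 0 (frontier (Icc a b))) {κ : ℂ} (hκ : κ ≠ 0)
    (heig : ∀ᵐ z ∂volume.restrict (rect a b), bracket p X Y z = κ * F z) :
    ∫ z in rect a b, F z = 0 := by
  have := h.setIntegral_bracket_eq_zero hab hp h0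
  rw [integral_congr_ae heig, integral_const_mul] at this
  exact (mul_eq_zero.1 this).resolve_left hκ

end Limits

section Grid

theorem setIntegral_rect_grid {E : Type*} [NormedAddCommGroup E] [NormedSpace ℝ E] {x y : ℕ → ℝ}
    (hx : Monotone x) (hy : Monotone y) (M N : ℕ) {g : ℝ × ℝ → E}
    (hg : IntegrableOn g (rect (x 0, y 0) (x M, y N))) :
    ∫ z in rect (x 0, y 0) (x M, y N), g z = ∑ i ∈ Finset.range M, ∑ j ∈ Finset.range N,
      ∫ z in rect (x i, y j) (x (i + 1), y (j + 1)), g z := by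
  have hunion : rect (x 0, y 0) (x M, y N) = ⋃ ij ∈ Finset.range M ×ˢ Finset.range N,
      rect (x ij.1, y ij.2) (x (ij.1 + 1), y (ij.2 + 1)) := by
    ext z
    rw [rect, ← hx.biUnion_Ico_Ioc_map_succ, ← hy.biUnion_Ico_Ioc_map_succ]
    simp only [rect, mem_prod,
      mem_iUnion, Finset.mem_product, Finset.mem_range, mem_Ico, Nat.zero_le, true_and,
      Order.succ_eq_add_one, Prod.exists, exists_prop]
    tauto
  rw [← Finset.sum_product', hunion]
  rw [hunion] at hg
  refine integral_biUnion_finset _ (fun ij _ => measurableSet_rect _ _) (fun ij _ kl _ hne => ?_)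
    fun ij hij => hg.mono_set (subset_biUnion_of_mem (u := fun ij : ℕ × ℕ =>
      rect (x ij.1, y ij.2) (x (ij.1 + 1), y (ij.2 + 1))) hij)
  rcases ne_or_eq ij.1 kl.1 with h1 | h1
  · exact Set.disjoint_prod.2 (Or.inl (hx.pairwise_disjoint_on_Ioc_succ h1))
  · exact Set.disjoint_prod.2
      (Or.inr (hy.pairwise_disjoint_on_Ioc_succ fun h2 => hne (Prod.ext h1 h2)))

theorem EdgeAveragesTendsto.exists_forall_grid {ι E : Type*} [NormedAddCommGroup E]
    [NormedSpace ℝ E] {l : Filter ι} [l.NeBot] {f : ι → ℝ × ℝ → E} {x y : ℕ → ℝ} {M N : ℕ}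
    (h : ∀ i < M, ∀ j < N,
      ∃ c, EdgeAveragesTendsto f l (x i, y j) (x (i + 1), y (j + 1)) c) :
    ∃ c, ∀ i < M, ∀ j < N, EdgeAveragesTendsto f l (x i, y j) (x (i + 1), y (j + 1)) c := by
  rcases M.eq_zero_or_pos with rfl | hM
  · simp
  rcases N.eq_zero_or_pos with rfl | hN
  · simp
  obtain ⟨c, hc⟩ := h 0 hM 0 hN
  have column : ∀ j < N, EdgeAveragesTendsto f l (x 0, y j) (x 1, y (j + 1)) c := by
    intro j
    induction j with
    | zero => exact fun _ => hc
    | succ j ih =>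
      intro hj
      obtain ⟨c', hc'⟩ := h 0 hM (j + 1) hj
      rwa [tendsto_nhds_unique (ih (by lia)).top hc'.bottom]
  refine ⟨c, fun i => ?_⟩
  induction i with
  | zero => exact fun _ => column
  | succ i ih =>
    intro hi j hj
    obtain ⟨c', hc'⟩ := h (i + 1) hi j hj
    rwa [tendsto_nhds_unique (ih (by lia) j hj).right hc'.left]

variable {ι : Type*} {l : Filter ι} [l.NeBot] {f : ι → ℝ × ℝ → ℂ} {F X Y : ℝ × ℝ → ℂ}
  {x y : ℕ → ℝ} {M N : ℕ} {p : ℝ × ℝ → ℝ} {κ : ℂ}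

theorem rect_grid_subset (hx : Monotone x) (hy : Monotone y) {i j : ℕ} (hi : i < M) (hj : j < N) :
    rect (x i, y j) (x (i + 1), y (j + 1)) ⊆ rect (x 0, y 0) (x M, y N) :=
  prod_mono (Ioc_subset_Ioc (hx i.zero_le) (hx hi)) (Ioc_subset_Ioc (hy j.zero_le) (hy hj))

namespace H1Tendsto

theorem exists_forall_cell_norm_sub_sq_le (h : H1Tendsto f l (rect (x 0, y 0) (x M, y N)) F X Y)
    (hx : StrictMono x) (hy : StrictMono y) (hp : ContDiff ℝ 2 p)
    (h0 : ∀ i j, EqOn p 0 (frontier (Icc (x i, y j) (x (i + 1), y (j + 1)))))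
    (hne : ∀ᵐ z, p z ≠ 0)
    (heig : ∀ᵐ z ∂volume.restrict (rect (x 0, y 0) (x M, y N)), bracket p X Y z = κ * F z) :
    ∃ c, ∀ i < M, ∀ j < N, ∫ z in rect (x i, y j) (x (i + 1), y (j + 1)), ‖F z - c‖ ^ 2
      ≤ 2 * (x (i + 1) - x i) ^ 2 * (∫ z in rect (x i, y j) (x (i + 1), y (j + 1)), ‖X z‖ ^ 2)
        + 2 * (y (j + 1) - y j) ^ 2
          * ∫ z in rect (x i, y j) (x (i + 1), y (j + 1)), ‖Y z‖ ^ 2 := by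
  have cell {i j} (hi : i < M) (hj : j < N) :
      H1Tendsto f l (rect (x i, y j) (x (i + 1), y (j + 1))) F X Y :=
    h.mono (rect_grid_subset hx.monotone hy.monotone hi hj)
  have heig' {i j} (hi : i < M) (hj : j < N) := ae_restrict_of_ae_restrict_of_subset
    (rect_grid_subset hx.monotone hy.monotone hi hj) heig
  have hx' (i) : x i < x (i + 1) := hx i.lt_succ_self
  have hy' (j) : y j < y (j + 1) := hy j.lt_succ_self
  have hab (i j) : (x i, y j) ≤ (x (i + 1), y (j + 1)) := ⟨(hx' i).le, (hy' j).le⟩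
  rcases eq_or_ne κ 0 with rfl | hκ
  · simp only [zero_mul] at heig'
    obtain ⟨c, hc⟩ := EdgeAveragesTendsto.exists_forall_grid fun i hi j hj =>
      (cell hi hj).exists_edgeAveragesTendsto (hx' i) (hy' j) fun ℓ hℓ =>
        (cell hi hj).setIntegral_bracket_eq_zero_of_ae_eq_zero (hab i j) hp (h0 i j)
          (ae_restrict_of_ae hne) (heig' hi hj) hℓ
    exact ⟨c, fun i hi j hj =>
      (cell hi hj).setIntegral_norm_sub_sq_le (hx' i) (hy' j) (hc i hi j hj).bottom⟩
  · refine ⟨0, fun i hi j hj => ?_⟩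
    obtain ⟨c, hc⟩ := (cell hi hj).exists_tendsto_average_bottom (hx' i).le (hy' j)
    have hmean := (cell hi hj).setIntegral_eq_zero (hab i j) hp (h0 i j) hκ (heig' hi hj)
    simp only [sub_zero]
    exact (integral_norm_sq_le_of_integral_eq_zero (cell hi hj).memLp hmean c).trans
      ((cell hi hj).setIntegral_norm_sub_sq_le (hx' i) (hy' j) hc)

theorem exists_setIntegral_norm_sub_sq_le (h : H1Tendsto f l (rect (x 0, y 0) (x M, y N)) F X Y)
    (hx : StrictMono x) (hy : StrictMono y) (hp : ContDiff ℝ 2 p)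
    (h0 : ∀ i j, EqOn p 0 (frontier (Icc (x i, y j) (x (i + 1), y (j + 1)))))
    (hne : ∀ᵐ z, p z ≠ 0)
    (heig : ∀ᵐ z ∂volume.restrict (rect (x 0, y 0) (x M, y N)), bracket p X Y z = κ * F z)
    {d : ℝ} (hdx : ∀ i, x (i + 1) - x i ≤ d) (hdy : ∀ j, y (j + 1) - y j ≤ d) :
    ∃ c, ∫ z in rect (x 0, y 0) (x M, y N), ‖F z - c‖ ^ 2
      ≤ 2 * d ^ 2 * ∫ z in rect (x 0, y 0) (x M, y N), (‖X z‖ ^ 2 + ‖Y z‖ ^ 2) := by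
  obtain ⟨c, hc⟩ := h.exists_forall_cell_norm_sub_sq_le hx hy hp h0 hne heig
  have hX : IntegrableOn (fun z => ‖X z‖ ^ 2) (rect (x 0, y 0) (x M, y N)) :=
    h.memLp_dx.norm.integrable_sq
  have hY : IntegrableOn (fun z => ‖Y z‖ ^ 2) (rect (x 0, y 0) (x M, y N)) :=
    h.memLp_dy.norm.integrable_sq
  have hXY : IntegrableOn (fun z => ‖X z‖ ^ 2 + ‖Y z‖ ^ 2) (rect (x 0, y 0) (x M, y N)) :=
    hX.add hY
  refine ⟨c, ?_⟩
  have hF : IntegrableOn (fun z => ‖F z - c‖ ^ 2) (rect (x 0, y 0) (x M, y N)) :=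
    (h.memLp.sub (memLp_const c)).norm.integrable_sq
  rw [setIntegral_rect_grid hx.monotone hy.monotone M N hF,
    setIntegral_rect_grid hx.monotone hy.monotone M N hXY, Finset.mul_sum]
  refine Finset.sum_le_sum fun i hi => ?_
  rw [Finset.mul_sum]
  refine Finset.sum_le_sum fun j hj => ?_
  rw [Finset.mem_range] at hi hj
  have hsub := rect_grid_subset hx.monotone hy.monotone hi hj
  refine (hc i hi j hj).trans ?_
  rw [integral_add (hX.mono_set hsub) (hY.mono_set hsub), mul_add]
  gcongr
  · exact sub_nonneg.2 (hx i.lt_succ_self).le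
  · exact hdx i
  · exact sub_nonneg.2 (hy j.lt_succ_self).le
  · exact hdy j

end H1Tendsto

end Grid

section Fourier

open UnitAddTorus

variable {d : Type*} [Fintype d]

theorem volume_unitAddTorus :
    (volume : Measure (UnitAddTorus d)) = Measure.pi fun _ => AddCircle.haarAddCircle := by
  rw [volume_pi, AddCircle.volume_eq_smul_haarAddCircle, ENNReal.ofReal_one, one_smul]

/-- The partial sum of the Fourier series of `g` over the frequencies in `S`. -/
noncomputable def fourierSum (S : Finset (d → ℤ)) (g : UnitAddTorus d → ℂ) : C(UnitAddTorus d, ℂ) :=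
  ∑ k ∈ S, mFourierCoeff g k • mFourier k

theorem fourierSum_apply (S : Finset (d → ℤ)) (g : UnitAddTorus d → ℂ) (p : UnitAddTorus d) :
    fourierSum S g p = ∑ k ∈ S, mFourierCoeff g k * mFourier k p := by
  simp [fourierSum]

theorem mFourierCoeff_eq_integral_volume (g : UnitAddTorus d → ℂ) (k : d → ℤ) :
    mFourierCoeff g k = ∫ p, g p * mFourier (-k) p := by
  rw [volume_unitAddTorus]
  exact integral_congr_ae (Eventually.of_forall fun p => mul_comm _ _)

theorem tendsto_toLp_fourierSum {ν : Measure (UnitAddTorus d)} [IsFiniteMeasure ν]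
    (hν : ν = Measure.pi fun _ => AddCircle.haarAddCircle) {g : UnitAddTorus d → ℂ}
    (hg : MemLp g 2 ν) :
    Tendsto (fun S => ContinuousMap.toLp 2 ν ℂ (fourierSum S g)) atTop (𝓝 (hg.toLp g)) := by
  subst hν
  refine (hasSum_mFourier_series_L2 (hg.toLp g)).congr fun S => ?_
  have hcoeff (k) : mFourierCoeff (hg.toLp g) k = mFourierCoeff g k :=
    integral_congr_ae (hg.coeFn_toLp.mono fun p hp => congrArg (mFourier (-k) p • ·) hp)
  simp only [fourierSum, hcoeff, map_sum, map_smul]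
  rfl

theorem tendsto_eLpNorm_fourierSum_sub {g : UnitAddTorus d → ℂ} (hg : MemLp g 2 volume) :
    Tendsto (fun S => eLpNorm (⇑(fourierSum S g) - g) 2 volume) atTop (𝓝 0) := by
  have hS (S) : MemLp (fourierSum S g) 2 volume :=
    (fourierSum S g).continuous.memLp_of_hasCompactSupport (HasCompactSupport.of_compactSpace _)
  exact (Lp.tendsto_Lp_iff_tendsto_eLpNorm'' (fun S => fourierSum S g) hS g hg).1
    (tendsto_toLp_fourierSum volume_unitAddTorus hg)

theorem mFourier_add_single [DecidableEq d] (k : d → ℤ) (p : UnitAddTorus d) (i : d)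
    (u : UnitAddCircle) : mFourier k (p + Pi.single i u) = mFourier k p * fourier (k i) u := by
  have hsingle : ∏ j, fourier (k j) ((Pi.single i u : UnitAddTorus d) j) = fourier (k i) u := by
    rw [Finset.prod_eq_single i (fun j _ hj => by rw [Pi.single_eq_of_ne hj, fourier_eval_zero])
      (by simp), Pi.single_eq_same]
  simp only [mFourier, ContinuousMap.coe_mk, ← hsingle, ← Finset.prod_mul_distrib, Pi.add_apply,
    fourier_apply, smul_add, AddCircle.toCircle_add, Circle.coe_mul]

theorem hasDerivAt_mFourier_add_single [DecidableEq d] (k : d → ℤ) (p : UnitAddTorus d) (i : d) :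
    HasDerivAt (fun t : ℝ => mFourier k (p + Pi.single i (t : UnitAddCircle)))
      (2 * Real.pi * Complex.I * k i * mFourier k p) 0 := by
  simp only [mFourier_add_single]
  refine ((hasDerivAt_fourier 1 (k i) 0).const_mul (mFourier k p)).congr_deriv ?_
  simp
  ring

theorem isSmooth_mFourier (k : Fin 2 → ℤ) : IsSmooth (mFourier k) := by
  have hexp : (fun x : Fin 2 → ℝ => mFourier k fun i => (x i : UnitAddCircle))
      = fun x => ∏ i, Complex.exp (2 * Real.pi * Complex.I * k i * (x i : ℝ)) := by
    funext x
    simp [mFourier]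
  rw [IsSmooth, hexp]
  exact contDiff_prod fun i _ => ContDiff.cexp
    (contDiff_const.mul (Complex.ofRealCLM.contDiff.comp (contDiff_apply ℝ ℝ i)))

theorem isSmooth_fourierSum (S : Finset (Fin 2 → ℤ)) (g : T2 → ℂ) : IsSmooth (fourierSum S g) := by
  simp only [IsSmooth, fourierSum_apply]
  exact ContDiff.sum fun k _ => contDiff_const.mul (isSmooth_mFourier k)

theorem HasWeakGradient.mFourierCoeff_eq {φ : T2 → ℂ} {G : T2 → Fin 2 → ℂ}
    (h : HasWeakGradient φ G) (i : Fin 2) (k : Fin 2 → ℤ) :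
    mFourierCoeff (fun p => G p i) k = 2 * Real.pi * Complex.I * k i * mFourierCoeff φ k := by
  have hk := h i _ (isSmooth_mFourier (-k))
  have hderiv (p) := (hasDerivAt_mFourier_add_single (-k) p i).deriv
  simp only [partialDeriv, hderiv] at hk
  rw [mFourierCoeff_eq_integral_volume, ← neg_eq_iff_eq_neg.2 hk, mFourierCoeff_eq_integral_volume,
    ← integral_const_mul, ← integral_neg]
  refine integral_congr_ae (Eventually.of_forall fun p => ?_)
  simp only [Pi.neg_apply]
  push_cast
  ring

theorem HasWeakGradient.partialDeriv_fourierSum {φ : T2 → ℂ} {G : T2 → Fin 2 → ℂ}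
    (h : HasWeakGradient φ G) (S : Finset (Fin 2 → ℤ)) (i : Fin 2) (p : T2) :
    partialDeriv i (fourierSum S φ) p = fourierSum S (fun p => G p i) p := by
  simp only [partialDeriv, fourierSum_apply, h.mFourierCoeff_eq]
  rw [(HasDerivAt.fun_sum fun k _ =>
    (hasDerivAt_mFourier_add_single k p i).const_mul (mFourierCoeff φ k)).deriv]
  exact Finset.sum_congr rfl fun k _ => by ring

end Fourier

section Torus

/-- The covering map `ℝ² → 𝕋²`, through which functions on the torus are read on the plane. -/
def proj (z : ℝ × ℝ) : T2 := ![(z.1 : UnitAddCircle), (z.2 : UnitAddCircle)]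

theorem measurePreserving_proj {a b : ℝ × ℝ} (h1 : b.1 = a.1 + 1) (h2 : b.2 = a.2 + 1) :
    MeasurePreserving proj (volume.restrict (rect a b)) volume := by
  have hmk := (UnitAddCircle.measurePreserving_mk a.1).prod (UnitAddCircle.measurePreserving_mk a.2)
  rw [Measure.prod_restrict, ← Measure.volume_eq_prod, ← h1, ← h2] at hmk
  exact (volume_preserving_finTwoArrow UnitAddCircle).symm.comp hmk

theorem setIntegral_comp_proj {E : Type*} [NormedAddCommGroup E] [NormedSpace ℝ E] {a b : ℝ × ℝ}
    (h1 : b.1 = a.1 + 1) (h2 : b.2 = a.2 + 1) {g : T2 → E} (hg : AEStronglyMeasurable g volume) :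
    ∫ z in rect a b, g (proj z) = ∫ p, g p := by
  have h := measurePreserving_proj h1 h2
  rw [← h.map_eq] at hg ⊢
  exact (integral_map h.measurable.aemeasurable hg).symm

theorem proj_add_single_zero (z : ℝ × ℝ) (t : ℝ) :
    proj z + Pi.single 0 (t : UnitAddCircle) = proj (z.1 + t, z.2) := by
  funext i
  fin_cases i <;> simp [proj]

theorem proj_add_single_one (z : ℝ × ℝ) (t : ℝ) :
    proj z + Pi.single 1 (t : UnitAddCircle) = proj (z.1, z.2 + t) := by
  funext i
  fin_cases i <;> simp [proj]

theorem partialDeriv_zero_proj {E : Type*} [NormedAddCommGroup E] [NormedSpace ℝ E] {f : T2 → E}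
    {z : ℝ × ℝ} (hf : DifferentiableAt ℝ (fun z => f (proj z)) z) :
    partialDeriv 0 f (proj z) = dx (fun z => f (proj z)) z := by
  simp only [partialDeriv, proj_add_single_zero]
  have h : HasDerivAt (fun s => f (proj (s, z.2))) (dx (fun z => f (proj z)) z) (z.1 + 0) := by
    rw [add_zero]
    exact hasDerivAt_dx hf
  exact (h.comp_const_add z.1 0).deriv

theorem partialDeriv_one_proj {E : Type*} [NormedAddCommGroup E] [NormedSpace ℝ E] {f : T2 → E}
    {z : ℝ × ℝ} (hf : DifferentiableAt ℝ (fun z => f (proj z)) z) :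
    partialDeriv 1 f (proj z) = dy (fun z => f (proj z)) z := by
  simp only [partialDeriv, proj_add_single_one]
  have h : HasDerivAt (fun t => f (proj (z.1, t))) (dy (fun z => f (proj z)) z) (z.2 + 0) := by
    rw [add_zero]
    exact hasDerivAt_dy hf
  exact (h.comp_const_add z.2 0).deriv

theorem IsSmooth.contDiff_comp_proj {f : T2 → ℂ} (hf : IsSmooth f) :
    ContDiff ℝ ∞ fun z => f (proj z) := by
  have hvec : ContDiff ℝ ∞ fun z : ℝ × ℝ => ![z.1, z.2] :=
    contDiff_pi.2 (Fin.forall_fin_two.2 ⟨contDiff_fst, contDiff_snd⟩)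
  have hproj (z : ℝ × ℝ) : proj z = fun i => ((![z.1, z.2] i : ℝ) : UnitAddCircle) := by
    funext i
    fin_cases i <;> rfl
  simp only [hproj]
  exact ContDiff.comp (g := fun x : Fin 2 → ℝ => f fun i => (x i : UnitAddCircle)) hf hvec

theorem HasWeakGradient.h1Tendsto {φ : T2 → ℂ} {G : T2 → Fin 2 → ℂ} (h : HasWeakGradient φ G)
    (hφ : MemLp φ 2 volume) (hG : ∀ i, MemLp (fun p => G p i) 2 volume) {a b : ℝ × ℝ}
    (h1 : b.1 = a.1 + 1) (h2 : b.2 = a.2 + 1) :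
    H1Tendsto (fun S z => fourierSum S φ (proj z)) atTop (rect a b) (fun z => φ (proj z))
      (fun z => G (proj z) 0) fun z => G (proj z) 1 := by
  have hproj := measurePreserving_proj h1 h2
  have hsmooth (S) : ContDiff ℝ 1 fun z => fourierSum S φ (proj z) :=
    (isSmooth_fourierSum S φ).contDiff_comp_proj.of_le (by simp)
  have hdiff (S) (z) := (hsmooth S).differentiable one_ne_zero z
  have hdx (S) : dx (fun z => fourierSum S φ (proj z))
      = fun z => fourierSum S (fun p => G p 0) (proj z) :=
    funext fun z => by rw [← partialDeriv_zero_proj (hdiff S z), h.partialDeriv_fourierSum]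
  have hdy (S) : dy (fun z => fourierSum S φ (proj z))
      = fun z => fourierSum S (fun p => G p 1) (proj z) :=
    funext fun z => by rw [← partialDeriv_one_proj (hdiff S z), h.partialDeriv_fourierSum]
  have hlim {g : T2 → ℂ} (hg : MemLp g 2 volume) :
      Tendsto (fun S => eLpNorm ((fun z => fourierSum S g (proj z)) - fun z => g (proj z)) 2
        (volume.restrict (rect a b))) atTop (𝓝 0) :=
    (tendsto_eLpNorm_fourierSum_sub hg).congr fun S => (eLpNorm_comp_measurePreserving
      ((fourierSum S g).continuous.aestronglyMeasurable.sub hg.1) hproj).symm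
  exact {
    contDiff := hsmooth
    memLp := hφ.comp_measurePreserving hproj
    memLp_dx := (hG 0).comp_measurePreserving hproj
    memLp_dy := (hG 1).comp_measurePreserving hproj
    tendsto := hlim hφ
    tendsto_dx := by simpa only [hdx] using hlim (hG 0)
    tendsto_dy := by simpa only [hdy] using hlim (hG 1) }

end Torus

section Cells

theorem ae_sin_mul_add_ne_zero {c : ℝ} (hc : c ≠ 0) (b : ℝ) :
    ∀ᵐ x : ℝ, Real.sin (c * x + b) ≠ 0 := by
  have hzero : {x : ℝ | Real.sin (c * x + b) = 0} ⊆ range fun k : ℤ => (k * Real.pi - b) / c := by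
    intro x hx
    obtain ⟨k, hk⟩ := Real.sin_eq_zero_iff.1 hx
    exact ⟨k, by simp only [hk]; field_simp; ring⟩
  simpa [ae_iff] using ((countable_range _).mono hzero).measure_zero volume

/-- The lift of the stream function `Ψ_n` to the plane. -/
noncomputable def planeStream (n : ℕ) (z : ℝ × ℝ) : ℝ :=
  Real.sin (2 * Real.pi * n * z.1) * Real.cos (2 * Real.pi * n * z.2)

theorem stream_proj (n : ℕ) (z : ℝ × ℝ) : stream n (proj z) = planeStream n z := by
  simp [stream, planeStream, proj, Function.Periodic.lift_coe]

theorem contDiff_planeStream (n : ℕ) {m : WithTop ℕ∞} : ContDiff ℝ m (planeStream n) := by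
  unfold planeStream
  fun_prop

theorem ae_planeStream_ne_zero {n : ℕ} (hn : n ≠ 0) : ∀ᵐ z, planeStream n z ≠ 0 := by
  have hc : 2 * Real.pi * n ≠ 0 := by positivity
  filter_upwards [Measure.quasiMeasurePreserving_fst.ae (ae_sin_mul_add_ne_zero hc 0),
    Measure.quasiMeasurePreserving_snd.ae (ae_sin_mul_add_ne_zero hc (Real.pi / 2))] with z hz1 hz2
  rw [add_zero] at hz1
  rw [Real.sin_add_pi_div_two] at hz2
  exact mul_ne_zero hz1 hz2

theorem sum_cellularFlow_proj (n : ℕ) (G : Fin 2 → T2 → ℂ) (z : ℝ × ℝ) :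
    ∑ i, (cellularFlow n (proj z) i : ℂ) * G i (proj z)
      = bracket (planeStream n) (fun z => G 0 (proj z)) (fun z => G 1 (proj z)) z := by
  have hlift : (fun z => stream n (proj z)) = planeStream n := funext (stream_proj n)
  have hdiff : DifferentiableAt ℝ (fun z => stream n (proj z)) z := by
    rw [hlift]
    exact (contDiff_planeStream n).differentiable one_ne_zero z
  simp only [Fin.sum_univ_two, cellularFlow, gradPerp, Matrix.cons_val_zero, Matrix.cons_val_one,
    partialDeriv_zero_proj hdiff, partialDeriv_one_proj hdiff, hlift, bracket, Complex.real_smul]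
  push_cast
  ring

/-- The abscissae `i / 2n` of the vertical sides of the cells of `Ψ_n`. -/
noncomputable def gridX (n i : ℕ) : ℝ := i / (2 * n)

/-- The ordinates `j / 2n - 1 / 4n` of the horizontal sides of the cells of `Ψ_n`. -/
noncomputable def gridY (n j : ℕ) : ℝ := j / (2 * n) - 1 / (4 * n)

theorem planeStream_gridX {n : ℕ} (hn : n ≠ 0) (i : ℕ) (t : ℝ) :
    planeStream n (gridX n i, t) = 0 := by
  have h : 2 * Real.pi * n * gridX n i = i * Real.pi := by
    rw [gridX]
    field_simp
  simp [planeStream, h]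

theorem planeStream_gridY {n : ℕ} (hn : n ≠ 0) (j : ℕ) (s : ℝ) :
    planeStream n (s, gridY n j) = 0 := by
  have h : 2 * Real.pi * n * gridY n j = j * Real.pi - Real.pi / 2 := by
    rw [gridY]
    field_simp
    ring
  simp [planeStream, h, Real.cos_sub]

theorem gridX_succ_sub (n i : ℕ) : gridX n (i + 1) - gridX n i = 1 / (2 * n) := by
  simp only [gridX]
  push_cast
  ring

theorem gridY_succ_sub (n j : ℕ) : gridY n (j + 1) - gridY n j = 1 / (2 * n) := by
  simp only [gridY]
  push_cast
  ring

theorem strictMono_gridX {n : ℕ} (hn : n ≠ 0) : StrictMono (gridX n) :=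
  strictMono_nat_of_lt_succ fun i => sub_pos.1 (by rw [gridX_succ_sub]; positivity)

theorem strictMono_gridY {n : ℕ} (hn : n ≠ 0) : StrictMono (gridY n) :=
  strictMono_nat_of_lt_succ fun j => sub_pos.1 (by rw [gridY_succ_sub]; positivity)

theorem planeStream_eqOn_frontier {n : ℕ} (hn : n ≠ 0) (i j : ℕ) :
    EqOn (planeStream n) 0
      (frontier (Icc (gridX n i, gridY n j) (gridX n (i + 1), gridY n (j + 1)))) := by
  rintro ⟨s, t⟩ hz
  have hle : (gridX n i, gridY n j) ≤ (gridX n (i + 1), gridY n (j + 1)) :=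
    ⟨(strictMono_gridX hn).monotone i.le_succ, (strictMono_gridY hn).monotone j.le_succ⟩
  obtain ⟨-, rfl | rfl⟩ | ⟨rfl | rfl, -⟩ := (mem_frontier_Icc_iff hle).1 hz
  · exact planeStream_gridY hn j s
  · exact planeStream_gridY hn (j + 1) s
  · exact planeStream_gridX hn i t
  · exact planeStream_gridX hn (i + 1) t

theorem exists_integral_norm_sub_sq_le {n : ℕ} (hn : n ≠ 0) {φ : T2 → ℂ} {G : T2 → Fin 2 → ℂ}
    (h : HasWeakGradient φ G) (hφ : MemLp φ 2 volume) (hG : ∀ i, MemLp (fun p => G p i) 2 volume)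
    {κ : ℂ} (heig : ∀ᵐ p, ∑ i, (cellularFlow n p i : ℂ) * G p i = κ * φ p) :
    ∃ c, 2 * (n : ℝ) ^ 2 * ∫ p, ‖φ p - c‖ ^ 2 ≤ ∫ p, ∑ i, ‖G p i‖ ^ 2 := by
  have h1 : gridX n (2 * n) = gridX n 0 + 1 := by
    simp only [gridX]
    push_cast
    field_simp
    ring
  have h2 : gridY n (2 * n) = gridY n 0 + 1 := by
    simp only [gridY]
    push_cast
    field_simp
    ring
  have heig' := (measurePreserving_proj (a := (gridX n 0, gridY n 0))
    (b := (gridX n (2 * n), gridY n (2 * n))) h1 h2).quasiMeasurePreserving.ae heig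
  simp only [sum_cellularFlow_proj n fun i p => G p i] at heig'
  obtain ⟨c, hc⟩ := (h.h1Tendsto hφ hG h1 h2).exists_setIntegral_norm_sub_sq_le
    (strictMono_gridX hn) (strictMono_gridY hn) (contDiff_planeStream n)
    (planeStream_eqOn_frontier hn) (ae_planeStream_ne_zero hn) heig'
    (fun i => (gridX_succ_sub n i).le) (fun j => (gridY_succ_sub n j).le)
  have hmeas : AEStronglyMeasurable (fun p => ‖G p 0‖ ^ 2 + ‖G p 1‖ ^ 2) volume :=
    ((hG 0).1.norm.pow 2).add ((hG 1).1.norm.pow 2)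
  rw [setIntegral_comp_proj (g := fun p => ‖φ p - c‖ ^ 2) h1 h2
    ((hφ.1.sub aestronglyMeasurable_const).norm.pow 2),
    setIntegral_comp_proj (g := fun p => ‖G p 0‖ ^ 2 + ‖G p 1‖ ^ 2) h1 h2 hmeas] at hc
  refine ⟨c, ?_⟩
  simp only [Fin.sum_univ_two]
  field_simp at hc
  linarith

theorem two_mul_sq_mul_l2NormSq_le_dirichletEnergy {n : ℕ} (hn : n ≠ 0) {φ : T2 → ℂ}
    (hφ : φ ∈ eigenfunctions (cellularFlow n)) :
    2 * (n : ℝ) ^ 2 * l2NormSq φ ≤ dirichletEnergy φ := by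
  obtain ⟨hH, hmean, μ, hμ⟩ := hφ
  obtain ⟨hG, hw⟩ : (∀ i, MemLp (fun p => weakGrad φ p i) 2 volume) ∧
      HasWeakGradient φ (weakGrad φ) := by
    simp only [weakGrad, dif_pos hH]
    exact hH.2.choose_spec
  obtain ⟨c, hc⟩ := exists_integral_norm_sub_sq_le hn hw hH.1 hG hμ
  refine le_trans ?_ hc
  gcongr
  exact integral_norm_sq_le_of_integral_eq_zero hH.1 hmean c

theorem l2NormSq_pos {φ : T2 → ℂ} (hφ : MemLp φ 2 volume) (h0 : ¬φ =ᵐ[volume] 0) :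
    0 < l2NormSq φ := by
  refine (integral_nonneg fun p => sq_nonneg _).lt_of_ne' fun h => h0 ?_
  filter_upwards [(integral_eq_zero_iff_of_nonneg (fun p => sq_nonneg _)
    hφ.norm.integrable_sq).1 h] with p hp
  simpa using hp

end Cells

end CellularFlow

theorem mainTheorem3 :
    ∃ δ : ℝ, 0 < δ ∧ ∀ n : ℕ, 1 ≤ n →
      ENNReal.ofReal (δ * (n : ℝ) ^ 2) ≤ CellularFlow.rate (CellularFlow.cellularFlow n) ∧
      ∀ φ ∈ CellularFlow.eigenfunctions (CellularFlow.cellularFlow n),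
        δ * (n : ℝ) ^ 2 * CellularFlow.l2NormSq φ ≤ CellularFlow.dirichletEnergy φ := by
  refine ⟨2, two_pos, fun n hn => ⟨?_, fun φ hφ => ?_⟩⟩
  · refine le_iInf₂ fun φ hφ => ENNReal.ofReal_le_ofReal ?_
    rw [le_div_iff₀ (CellularFlow.l2NormSq_pos hφ.1.1.1 hφ.2)]
    exact CellularFlow.two_mul_sq_mul_l2NormSq_le_dirichletEnergy (Nat.one_le_iff_ne_zero.1 hn) hφ.1
  · exact CellularFlow.two_mul_sq_mul_l2NormSq_le_dirichletEnergy (Nat.one_le_iff_ne_zero.1 hn) hφ
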